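/- Let $\mathcal I=(I_0=\emptyset,I_1,\dots,I_K)$ with $I_k\subseteq[p]$, and let $\mathcal G=([p],E)$ be a DAG with parent sets $\mathrm{pa}(i)$ and families $\mathrm{fa}(i)=\{i\}\cup\mathrm{pa}(i)$. The Gaussian interventional DAG model $\mathcal M(\mathcal G,\mathcal I)$ consists of the tuples $(f^0,\dots,f^K)$ of centred normal densities on $\mathbb R^p$, where $f^k$ is the density of the solution of $X_i=\sum_{j\in\mathrm{pa}(i)}\lambda^{(k)}_{ij}X_j+\varepsilon_i$ ($i\in[p]$) with independent $\varepsilon_i\sim N(0,\omega^{(k)}_i)$, $\omega_i^{(k)}>0$, and $\lambda^{(k)}_{ij}=\lambda^{(0)}_{ij}$, $\omega^{(k)}_i=\omega^{(0)}_i$ whenever $i\notin I_k$. Let $\mathbb D$ be a data set with observations $x^k_1,\dots,x^k_{n_k}\in\mathbb R^p$ in experiment $k\in\{0,\dots,K\}$, let $n=n_0+\dots+n_K$, let $\hat\theta$ be a maximum likelihood estimate (MLE) of the parameters given $\mathbb D$, and let $$\mathrm{BIC}(\mathcal G,\mathcal I;\mathbb D)=\log L(\hat\theta\mid\mathcal G,\mathcal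 I,\mathbb D)-\tfrac{\log n}{2}\cdot\#\{\text{free parameters}\}.$$ For nonempty $P\subseteq\{0,\dots,K\}$ let $S^{\mathrm{pool}(P)}=\big(\sum_{k\in P}n_k\big)^{-1}\sum_{k\in P}\sum_{j}x^k_j(x^k_j)^T$, and $S^{(k)}=S^{\mathrm{pool}(\{k\})}$. Let $S_A$ be the submatrix of $S$ with rows and columns in $A$, and let $M^{\mathrm{fill}}$ be the extension of $M$ by zeros to a $p\times p$ matrix. For $A\subseteq[p]$ and $\mathcal Z\subseteq\mathcal Z_{\mathcal I}=\{z_1,\dots,z_K\}$, with $Z=\{k:z_k\in\mathcal Z\}$ and $Z^c=\{0,\dots,K\}\setminus Z$, put $$\alpha_{A\sqcup\mathcal Z}=\sum_{k\in Z^c}\Big(\tfrac12\sum_{j=1}^{n_k}(x^k_j)^T\big((S_A^{\mathrm{pool}(Z^c)})^{-1}\big)^{\mathrm{fill}}x^k_j+\tfrac{n_k}2\log\det S_A^{\mathrm{pool}(Z^c)}\Big)+\sum_{k\in Z}\Big(\tfrac12\sum_{j=1}^{n_k}(x^k_j)^T\big((S_A^{(k)})^{-1}\big)^{\mathrm{fill}}x^k_j+\tfrac{n_k}2\log\det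 S_A^{(k)}\Big)+\tfrac{\log n}2(1+|Z|)\tbinom{|A|}2$$ (where the inverse and the logarithm of the determinant of a singular matrix are read as $0$), and $$C=-\sum_{k=0}^K\frac{p\,n_k}2\log(2\pi)-\frac{\log n}2\Big(p+\sum_{k=1}^K|I_k|\Big).$$ Write $Z_i=\{k:i\in I_k\}$, $Z_i^c=\{0,\dots,K\}\setminus Z_i$ and $\mathcal Z_i=\{z_k:k\in Z_i\}$. **Theorem.** (1) Suppose that for all $i\in[p]$ the matrices $S^{\mathrm{pool}(Z_i^c)}_{\mathrm{fa}(i)}$, and $S^{(k)}_{\mathrm{fa}(i)}$ for $k\in Z_i$, are positive definite. Then an MLE exists, and for every MLE $$\mathrm{BIC}(\mathcal G,\mathcal I;\mathbb D)=C+\sum_{i=1}^p\big(\alpha_{\mathrm{pa}(i)\sqcup\mathcal Z_i}-\alpha_{\mathrm{fa}(i)\sqcup\mathcal Z_i}\big).$$ Moreover, up to a constant that does not depend on $\mathcal G$, the BIC is a linear functional of the standard imset $u_{\mathcal G^{\mathcal I}}$: $$\mathrm{BIC}(\mathcal G,\mathcal I;\mathbb D)=C-\alpha_{[p]\sqcup\mathcal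 Z_{\mathcal I}}+\alpha_{\emptyset}+\langle\alpha,u_{\mathcal G^{\mathcal I}}\rangle.$$ Here $\mathcal G^{\mathcal I}$ is the DAG on $V=[p]\sqcup\mathcal Z_{\mathcal I}$ with the edges of $\mathcal G$ and the edges $z_k\to i$ for $i\in I_k$, $u_{\mathcal G^{\mathcal I}}=\delta_V-\delta_\emptyset+\sum_{v\in V}(\delta_{\mathrm{pa}(v)}-\delta_{\mathrm{fa}(v)})$ with $\mathrm{pa}(v)$ and $\mathrm{fa}(v)$ taken in $\mathcal G^{\mathcal I}$, and $\delta_A$ is the indicator function of $\{A\}$ on the power set of $V$. (2) If $\mathbb D$ is a random sample from an interventional setting $(f^0,\dots,f^K)\in\mathcal M(\mathcal H,\mathcal I)$ for some DAG $\mathcal H$ on $[p]$ (for instance $\mathcal H=\mathcal G$), that is, all observations are independent and those of experiment $k$ have density $f^k$, and if $\sum_{k\in Z_i^c}n_k\ge|\mathrm{fa}(i)|$ for all $i$ and $n_k\ge|\mathrm{fa}(i)|$ for all $k$ and $i\in I_k$, then the hypothesis of (1) holds with probability one. -/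

import Mathlib

open MeasureTheory ProbabilityTheory
open scoped Matrix

namespace GaussianIDAG

noncomputable section

/-! ### Directed acyclic graphs, intervention graphs and standard imsets -/

section Graphs

variable {V : Type*} [Fintype V] [DecidableEq V]

/-- A directed graph is a DAG if it has no directed cycle (in particular no loop). -/
def IsDAG (G : Digraph V) : Prop :=
  ∀ v, ¬ Relation.TransGen G.Adj v v

open Classical in
/-- The set `pa(v)` of parents of `v`. -/
def pa (G : Digraph V) (v : V) : Finset V :=
  Finset.univ.filter fun w => G.Adj w v

/-- The family `fa(v) = {v} ∪ pa(v)`. -/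
def fa (G : Digraph V) (v : V) : Finset V :=
  insert v (pa G v)

/-- The identifier function `δ_A` of a set `A`. -/
def delta (A : Finset V) : Finset V → ℤ :=
  fun B => if B = A then 1 else 0

/-- The standard imset
`u_G = δ_V - δ_∅ + ∑ v, (δ_{pa(v)} - δ_{fa(v)})` of a directed graph on `V`. -/
def standardImset (G : Digraph V) : Finset V → ℤ :=
  delta Finset.univ - delta ∅ + ∑ v, (delta (pa G v) - delta (fa G v))

end Graphs

variable {p K : ℕ}

/-- The `𝓘`-DAG `G^𝓘`. The vertex `i` of `G` is `Sum.inl i`; the vertices `z_1, …, z_K` are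
`Sum.inr 0, …, Sum.inr (K - 1)`, so that `Sum.inr k` stands for the experiment `k + 1`, whose
target is `I k.succ`. The edges are those of `G` together with `z_k → i` for `i ∈ I_k`. -/
def iDAG (G : Digraph (Fin p)) (I : Fin (K + 1) → Finset (Fin p)) :
    Digraph (Fin p ⊕ Fin K) where
  Adj
    | Sum.inl a, Sum.inl b => G.Adj a b
    | Sum.inr k, Sum.inl i => i ∈ I k.succ
    | _, Sum.inr _ => False

/-- The indices `Z_i = {k ∈ {0, …, K} : i ∈ I_k}` of the experiments that target `i`. -/
def targeting (I : Fin (K + 1) → Finset (Fin p)) (i : Fin p) : Finset (Fin (K + 1)) :=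
  Finset.univ.filter fun k => i ∈ I k

/-- The set `𝓩_i` of those vertices `z_k` of the `𝓘`-DAG with `i ∈ I_k`. -/
def targetingVertices (I : Fin (K + 1) → Finset (Fin p)) (i : Fin p) : Finset (Fin K) :=
  Finset.univ.filter fun k => i ∈ I k.succ

/-! ### The Gaussian interventional DAG model -/

/-- Families `((B^(k), ω^(k)) : k = 0, …, K)` of a coefficient matrix and a variance vector; the
entry `B^(k) i j` is the coefficient `λ_{ij}^(k)` of `X_j` in the structural equation
`X_i = ∑ j ∈ pa(i), λ_{ij}^(k) X_j + ε_i` with `Var ε_i = ω_i^(k)`. -/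
abbrev ParamVec (p K : ℕ) : Type :=
  (Fin (K + 1) → Matrix (Fin p) (Fin p) ℝ) × (Fin (K + 1) → Fin p → ℝ)

/-- The linear constraints of the model: coefficients live on the edges of `G`, and the
parameters of node `i` in experiment `k` agree with the observational ones if `i ∉ I_k`. -/
def paramSubmodule (G : Digraph (Fin p)) (I : Fin (K + 1) → Finset (Fin p)) :
    Submodule ℝ (ParamVec p K) where
  carrier := {θ |
    (∀ k i j, ¬ G.Adj j i → θ.1 k i j = 0) ∧
    (∀ k i, i ∉ I k → (∀ j, θ.1 k i j = θ.1 0 i j) ∧ θ.2 k i = θ.2 0 i)}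
  zero_mem' := by simp
  add_mem' := by
    rintro a b ⟨ha, ha'⟩ ⟨hb, hb'⟩
    refine ⟨fun k i j h => ?_, fun k i h => ⟨fun j => ?_, ?_⟩⟩
    · simp [ha k i j h, hb k i j h]
    · simp [(ha' k i h).1 j, (hb' k i h).1 j]
    · simp [(ha' k i h).2, (hb' k i h).2]
  smul_mem' := by
    rintro c a ⟨ha, ha'⟩
    refine ⟨fun k i j h => ?_, fun k i h => ⟨fun j => ?_, ?_⟩⟩
    · simp [ha k i j h]
    · simp [(ha' k i h).1 j]
    · simp [(ha' k i h).2]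

/-- The parameter space of the model: the error variances have to be positive. -/
def paramSpace (G : Digraph (Fin p)) (I : Fin (K + 1) → Finset (Fin p)) :
    Set (ParamVec p K) :=
  {θ | θ ∈ paramSubmodule G I ∧ ∀ k i, 0 < θ.2 k i}

/-- The number of free parameters: the dimension of the parameter space, which is relatively
open in `paramSubmodule G I`. -/
def numFreeParams (G : Digraph (Fin p)) (I : Fin (K + 1) → Finset (Fin p)) : ℕ :=
  Module.finrank ℝ (paramSubmodule G I)

/-- The covariance matrix `(1 - B)⁻¹ diag(ω) (1 - B)⁻ᵀ` of the solution `X` of `X = B X + ε`. -/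
def covMatrix (B : Matrix (Fin p) (Fin p) ℝ) (ω : Fin p → ℝ) : Matrix (Fin p) (Fin p) ℝ :=
  (1 - B)⁻¹ * Matrix.diagonal ω * ((1 - B)⁻¹)ᵀ

/-- The Gaussian interventional model `M(G, 𝓘)`, as a set of tuples
`(Σ^(0), …, Σ^(K))` of covariance matrices. -/
def gaussianModel (G : Digraph (Fin p)) (I : Fin (K + 1) → Finset (Fin p)) :
    Set (Fin (K + 1) → Matrix (Fin p) (Fin p) ℝ) :=
  {S | ∃ θ ∈ paramSpace G I, ∀ k, S k = covMatrix (θ.1 k) (θ.2 k)}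

/-- The density of the centred normal distribution on `ℝ^p` with covariance matrix `S`. -/
def gaussDensity (S : Matrix (Fin p) (Fin p) ℝ) (x : Fin p → ℝ) : ℝ :=
  (Real.sqrt ((2 * Real.pi) ^ p * S.det))⁻¹ * Real.exp (-(1 / 2) * (x ⬝ᵥ (S⁻¹ *ᵥ x)))

/-! ### Data, likelihood and the Bayesian information criterion -/

/-- Data sets with `n k` observations in experiment `k`; `D k j` is the `j`-th one. -/
abbrev Data (p : ℕ) {K : ℕ} (n : Fin (K + 1) → ℕ) : Type :=
  (k : Fin (K + 1)) → Fin (n k) → Fin p → ℝ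

variable {n : Fin (K + 1) → ℕ}

/-- The likelihood of the parameters `θ` given the data. -/
def likelihood (D : Data p n) (θ : ParamVec p K) : ℝ :=
  ∏ k, ∏ j, gaussDensity (covMatrix (θ.1 k) (θ.2 k)) (D k j)

/-- `θ` is a maximum likelihood estimate for the model `M(G, 𝓘)`. -/
def IsMLE (G : Digraph (Fin p)) (I : Fin (K + 1) → Finset (Fin p)) (D : Data p n)
    (θ : ParamVec p K) : Prop :=
  θ ∈ paramSpace G I ∧ ∀ θ' ∈ paramSpace G I, likelihood D θ' ≤ likelihood D θ

/-- The value `log L(θ) - (number of free parameters) * log n / 2`, where `n` is the total sample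
size. At a maximum likelihood estimate `θ` this is the BIC of `M(G, 𝓘)`. -/
def bic (G : Digraph (Fin p)) (I : Fin (K + 1) → Finset (Fin p)) (D : Data p n)
    (θ : ParamVec p K) : ℝ :=
  Real.log (likelihood D θ)
    - (numFreeParams G I : ℝ) * Real.log ((∑ k, n k : ℕ) : ℝ) / 2

/-- The sample covariance matrix `S^{pool(A)}` (for mean zero) of the data of all experiments
in `A`. -/
def sampleCov (D : Data p n) (A : Finset (Fin (K + 1))) : Matrix (Fin p) (Fin p) ℝ :=
  ((∑ k ∈ A, n k : ℕ) : ℝ)⁻¹ • ∑ k ∈ A, ∑ j, Matrix.vecMulVec (D k j) (D k j)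

/-- The submatrix `S_A` with rows and columns in `A`. -/
def sub (S : Matrix (Fin p) (Fin p) ℝ) (A : Finset (Fin p)) : Matrix A A ℝ :=
  S.submatrix Subtype.val Subtype.val

/-- The embedding of an `A × A` matrix into the `p × p` matrices, filled up with zeros. -/
def fill (A : Finset (Fin p)) (M : Matrix A A ℝ) : Matrix (Fin p) (Fin p) ℝ :=
  Matrix.of fun a b => if h : a ∈ A ∧ b ∈ A then M ⟨a, h.1⟩ ⟨b, h.2⟩ else 0

/-- The contribution
`(1/2) ∑ j, (x_j^k)ᵀ ((S_A)⁻¹)^fill x_j^k + (n_k / 2) log det S_A` of experiment `k`. -/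
def alphaTerm (D : Data p n) (S : Matrix (Fin p) (Fin p) ℝ) (A : Finset (Fin p))
    (k : Fin (K + 1)) : ℝ :=
  1 / 2 * ∑ j, D k j ⬝ᵥ (fill A (sub S A)⁻¹ *ᵥ D k j)
    + (n k : ℝ) / 2 * Real.log (sub S A).det

/-- The coordinate `α_{A ⊔ 𝓩}` of the data vector. Here `Z ⊆ {1, …, K}` is the set of indices of
the vertices in `𝓩`, and its complement is taken in `{0, …, K}`. -/
def alphaCoord (D : Data p n) (A : Finset (Fin p)) (𝓩 : Finset (Fin K)) : ℝ :=
  let Z : Finset (Fin (K + 1)) := 𝓩.map (Fin.succEmb K)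
  ∑ k ∈ Zᶜ, alphaTerm D (sampleCov D Zᶜ) A k
    + ∑ k ∈ Z, alphaTerm D (sampleCov D {k}) A k
    + Real.log ((∑ k, n k : ℕ) : ℝ) / 2 * (A.card.choose 2 : ℝ)
    + Real.log ((∑ k, n k : ℕ) : ℝ) / 2 * ∑ _k ∈ Z, (A.card.choose 2 : ℝ)

/-- The data vector `α`, indexed by the subsets of the vertex set of the `𝓘`-DAG. -/
def alphaVec (D : Data p n) (S : Finset (Fin p ⊕ Fin K)) : ℝ :=
  alphaCoord D S.toLeft S.toRight

/-- The constant `C`; it depends only on the sample sizes and the intervention targets. -/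
def constC (n : Fin (K + 1) → ℕ) (I : Fin (K + 1) → Finset (Fin p)) : ℝ :=
  -∑ k, (p * n k : ℝ) / 2 * Real.log (2 * Real.pi)
    - Real.log ((∑ k, n k : ℕ) : ℝ) / 2 * ((p : ℝ) + ∑ k : Fin K, ((I k.succ).card : ℝ))

/-- The marginal sample covariance matrices of the families that belong to the model `M(G, 𝓘)`
are positive definite. -/
def FamilyCovPosDef (G : Digraph (Fin p)) (I : Fin (K + 1) → Finset (Fin p))
    (D : Data p n) : Prop :=
  ∀ i, (sub (sampleCov D (targeting I i)ᶜ) (fa G i)).PosDef ∧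
    ∀ k ∈ targeting I i, (sub (sampleCov D {k}) (fa G i)).PosDef

/-- `X` is a random sample from the centred Gaussian distributions with covariance matrices
`S 0, …, S K`: all observations are independent, and those of experiment `k` have the normal
density with covariance matrix `S k`. -/
def IsGaussianSample {Ω : Type*} [MeasurableSpace Ω] (μ : Measure Ω)
    (S : Fin (K + 1) → Matrix (Fin p) (Fin p) ℝ) (X : Ω → Data p n) : Prop :=
  (∀ k j, HasLaw (fun w => X w k j)
    (volume.withDensity fun x => ENNReal.ofReal (gaussDensity (S k) x)) μ) ∧
  iIndepFun (fun (s : (k : Fin (K + 1)) × Fin (n k)) w => X w s.1 s.2) μ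

end

end GaussianIDAG

namespace GaussianIDAG

/-! Acyclicity gives `det (1 - B) = 1`, so the log-density splits into one Gaussian regression term
per node (`log_gaussDensity_covMatrix`). Node `i` has one parameter set shared by all experiments
outside `Z_i` and a separate one for each experiment in `Z_i`. No constraint links different nodes,
so the likelihood is maximised one regression at a time.

For a pool `P` with `N` observations, completing the square shows that the regression maximum is
`-(N/2)(log r + 1)`. Here `r = det S_fa / det S_pa` is the residual variance, a Schur complement. On
the other side, the quadratic terms of `α` sum to `(N/2) tr(S_A⁻¹ S_A) = (N/2)|A|`, so the
difference of the `pa` and `fa` terms is exactly this maximum (`sum_alphaTerm_pa_sub_fa`). The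
penalty agrees because `choose |fa| 2 - choose |pa| 2 = |pa|`; the remaining parameters are counted
by `C`. The imset formula follows since the vertices `z_k` contribute nothing: `α` vanishes on sets
without a vertex of `G`.

For random data, independent vectors with densities are almost surely in general position, since a
proper subspace is a null set (`ae_linearIndependent_pi`). Enough observations therefore span, and
the sample covariance is positive definite. -/

theorem det_one_sub_of_isDAG {V : Type*} [Fintype V] [DecidableEq V] {G : Digraph V}
    (hG : IsDAG G) {B : Matrix V V ℝ} (hB : ∀ i j, ¬ G.Adj j i → B i j = 0) :
    (1 - B).det = 1 := by
  rw [Matrix.det_apply', Finset.sum_eq_single 1]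
  · have hd : ∀ i, B i i = 0 := fun i => hB i i fun h => hG i (Relation.TransGen.single h)
    simp [hd]
  -- A nonzero Leibniz term for `σ ≠ 1` would make the orbit of a moved point a directed cycle.
  · intro σ _ hσ
    obtain ⟨i₀, hi₀⟩ : ∃ i, σ i ≠ i := by
      by_contra! h
      exact hσ (Equiv.ext h)
    by_contra hne
    have hadj : ∀ i, σ i ≠ i → G.Adj i (σ i) := by
      intro i hi
      by_contra h
      refine hne (mul_eq_zero_of_right _ (Finset.prod_eq_zero (Finset.mem_univ i) ?_))
      simp [hi, hB _ _ h]
    have hmove : ∀ m : ℕ, σ ((σ ^ m) i₀) ≠ (σ ^ m) i₀ := by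
      intro m h
      rw [← Equiv.Perm.mul_apply, ← pow_succ', pow_succ, Equiv.Perm.mul_apply] at h
      exact hi₀ ((σ ^ m).injective h)
    have hpath : ∀ m : ℕ, Relation.TransGen G.Adj i₀ ((σ ^ (m + 1)) i₀) := by
      intro m
      induction m with
      | zero => simpa using Relation.TransGen.single (hadj i₀ hi₀)
      | succ m ih =>
        refine ih.tail ?_
        rw [pow_succ' σ (m + 1), Equiv.Perm.mul_apply]
        exact hadj _ (hmove _)
    have hpos : 0 < orderOf σ := orderOf_pos σ
    have := hpath (orderOf σ - 1)
    rw [Nat.sub_add_cancel hpos, pow_orderOf_eq_one] at this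
    exact hG _ this
  · simp

/-! ### Nodewise factorisation of the Gaussian density -/

section Density

variable {p : ℕ} {G : Digraph (Fin p)} {B : Matrix (Fin p) (Fin p) ℝ} {ω : Fin p → ℝ}

theorem det_covMatrix (hG : IsDAG G) (hB : ∀ i j, ¬ G.Adj j i → B i j = 0) :
    (covMatrix B ω).det = ∏ i, ω i := by
  simp [covMatrix, Matrix.det_nonsing_inv, det_one_sub_of_isDAG hG hB]

theorem inv_covMatrix (hG : IsDAG G) (hB : ∀ i j, ¬ G.Adj j i → B i j = 0)
    (hω : ∀ i, 0 < ω i) :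
    (covMatrix B ω)⁻¹ = (1 - B)ᵀ * Matrix.diagonal (fun i => (ω i)⁻¹) * (1 - B) := by
  have hu : IsUnit (1 - B).det := by rw [det_one_sub_of_isDAG hG hB]; exact isUnit_one
  have hd : Matrix.diagonal ω * Matrix.diagonal (fun i => (ω i)⁻¹) = 1 := by
    rw [Matrix.diagonal_mul_diagonal, ← Matrix.diagonal_one]
    exact congrArg _ (funext fun i => mul_inv_cancel₀ (hω i).ne')
  refine Matrix.inv_eq_right_inv ?_
  have h1 : ((1 - B)⁻¹)ᵀ * (1 - B)ᵀ = 1 := by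
    rw [← Matrix.transpose_mul, Matrix.mul_nonsing_inv _ hu, Matrix.transpose_one]
  calc covMatrix B ω * ((1 - B)ᵀ * Matrix.diagonal (fun i => (ω i)⁻¹) * (1 - B))
      = (1 - B)⁻¹ * Matrix.diagonal ω * (((1 - B)⁻¹)ᵀ * (1 - B)ᵀ)
          * Matrix.diagonal (fun i => (ω i)⁻¹) * (1 - B) := by
        simp only [covMatrix, Matrix.mul_assoc]
    _ = (1 - B)⁻¹ * (Matrix.diagonal ω * Matrix.diagonal (fun i => (ω i)⁻¹)) * (1 - B) := by
        rw [h1, Matrix.mul_one]; simp only [Matrix.mul_assoc]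
    _ = 1 := by rw [hd, Matrix.mul_one, Matrix.nonsing_inv_mul _ hu]

theorem gaussDensity_covMatrix_pos (hG : IsDAG G) (hB : ∀ i j, ¬ G.Adj j i → B i j = 0)
    (hω : ∀ i, 0 < ω i) (x : Fin p → ℝ) : 0 < gaussDensity (covMatrix B ω) x := by
  have : 0 < ∏ i, ω i := Finset.prod_pos fun i _ => hω i
  rw [gaussDensity, det_covMatrix hG hB]
  positivity

/-- The precision matrix is `(1 - B)ᵀ diag(ω⁻¹) (1 - B)`, so the quadratic form is a weighted sum of
squared structural residuals, and the determinant is `∏ ω i`. -/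
theorem log_gaussDensity_covMatrix (hG : IsDAG G) (hB : ∀ i j, ¬ G.Adj j i → B i j = 0)
    (hω : ∀ i, 0 < ω i) (x : Fin p → ℝ) :
    Real.log (gaussDensity (covMatrix B ω) x) = -(p / 2 * Real.log (2 * Real.pi))
      + ∑ i, -(1 / 2) * (Real.log (ω i) + (x i - B i ⬝ᵥ x) ^ 2 / ω i) := by
  have hprod : 0 < ∏ i, ω i := Finset.prod_pos fun i _ => hω i
  have hq : x ⬝ᵥ ((covMatrix B ω)⁻¹ *ᵥ x) = ∑ i, (x i - B i ⬝ᵥ x) ^ 2 / ω i := by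
    rw [inv_covMatrix hG hB hω, ← Matrix.mulVec_mulVec, ← Matrix.mulVec_mulVec,
      Matrix.dotProduct_mulVec, Matrix.vecMul_transpose, Matrix.sub_mulVec, Matrix.one_mulVec]
    rw [dotProduct]
    refine Finset.sum_congr rfl fun i _ => ?_
    rw [Matrix.mulVec_diagonal]
    simp only [Pi.sub_apply, Matrix.mulVec]
    ring
  have hlog : Real.log (∏ i, ω i) = ∑ i, Real.log (ω i) :=
    Real.log_prod fun i _ => (hω i).ne'
  rw [gaussDensity, det_covMatrix hG hB, Real.log_mul (by positivity) (Real.exp_pos _).ne',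
    Real.log_exp, Real.log_inv, Real.log_sqrt (by positivity),
    Real.log_mul (by positivity) hprod.ne', Real.log_pow, hq, hlog, ← Finset.mul_sum,
    Finset.sum_add_distrib]
  ring

end Density

/-! ### General position of independent random vectors -/

section Generic

variable {E F : Type*} [NormedAddCommGroup E] [NormedSpace ℝ E]
  [NormedAddCommGroup F] [NormedSpace ℝ F] [FiniteDimensional ℝ F]
  [MeasurableSpace F] [BorelSpace F]

/-- Independent random vectors with absolutely continuous laws are in general position. -/
theorem ae_linearIndependent_pi (vol : Measure F) [vol.IsAddHaarMeasure] (L : F →L[ℝ] E)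
    (hL : Function.Surjective L) :
    ∀ (m : ℕ) (ν : Fin m → Measure F) [∀ i, IsProbabilityMeasure (ν i)],
      (∀ i, ν i ≪ vol) → m ≤ Module.finrank ℝ E →
      ∀ᵐ x ∂Measure.pi ν, LinearIndependent ℝ fun i => L (x i)
  | 0, ν, _, _, _ => by
    refine Filter.Eventually.of_forall fun x => ?_
    exact linearIndependent_empty_type
  | m + 1, ν, _, hν, hm => by
    have hmp := measurePreserving_piFinSuccAbove ν 0
    have ih := ae_linearIndependent_pi vol L hL m (fun i => ν (Fin.succ i))
      (fun i => hν _) (by omega)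
    have hopen : ∀ k : ℕ, IsOpen {x : Fin k → F | LinearIndependent ℝ fun i => L (x i)} :=
      fun k => (isOpen_setOfPred_linearIndependent (𝕜 := ℝ) (E := E) (ι := Fin k)).preimage
        (f := fun x : Fin k → F => fun i => L (x i)) (by fun_prop)
    let q : F × (Fin m → F) → Prop := fun z =>
      LinearIndependent ℝ fun i : Fin (m + 1) => L ((Fin.cons z.1 z.2 : Fin (m + 1) → F) i)
    have hqm : MeasurableSet {z | q z} := by
      refine ((hopen (m + 1)).preimage
        (f := fun z : F × (Fin m → F) => (Fin.cons z.1 z.2 : Fin (m + 1) → F)) ?_).measurableSet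
      fun_prop
    -- The factors are swapped so that Fubini fixes the last `m` vectors and lets the first one
    -- vary.
    have hq : ∀ᵐ z ∂(Measure.pi fun i => ν (Fin.succ i)).prod (ν 0), q z.swap := by
      rw [Measure.ae_prod_iff_ae_ae (p := fun z => q z.swap) (measurable_swap hqm)]
      filter_upwards [ih] with y hy
      have hspan : Submodule.span ℝ (Set.range fun i => L (y i)) ≠ ⊤ := by
        intro h
        have h1 := finrank_range_le_card (R := ℝ) (fun i => L (y i))
        rw [Set.finrank, h, finrank_top, Fintype.card_fin] at h1
        omega
      have hcomap : (Submodule.span ℝ (Set.range fun i => L (y i))).comap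
          (L : F →ₗ[ℝ] E) ≠ ⊤ := by
        intro h
        apply hspan
        rw [eq_top_iff]
        rintro e -
        obtain ⟨f, rfl⟩ := hL e
        have : f ∈ (Submodule.span ℝ (Set.range fun i => L (y i))).comap (L : F →ₗ[ℝ] E) := by
          rw [h]; trivial
        exact this
      -- The bad values of the first vector form the preimage under `L` of the span of `m < dim E`
      -- vectors. It is a proper subspace because `L` is onto, hence null.
      have h0 := hν 0 (Measure.addHaar_submodule vol _ hcomap)
      refine (measure_eq_zero_iff_ae_notMem.1 h0).mono fun x hx => ?_
      have : (fun i : Fin (m + 1) => L ((Fin.cons x y : Fin (m + 1) → F) i))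
          = Fin.cons (L x) (fun i => L (y i)) := by
        ext i
        refine Fin.cases ?_ (fun j => ?_) i <;> simp
      change LinearIndependent ℝ fun i : Fin (m + 1) => L ((Fin.cons x y : Fin (m + 1) → F) i)
      rw [this, linearIndependent_finCons]
      exact ⟨hy, hx⟩
    have hq' : ∀ᵐ z ∂(ν 0).prod (Measure.pi fun i => ν (Fin.succ i)), q z := by
      rw [← Measure.prod_swap]
      exact (ae_map_iff measurable_swap.aemeasurable hqm).2 hq
    have := hmp.quasiMeasurePreserving.ae hq'
    filter_upwards [this] with x hx
    have hc : (Fin.cons (x 0) (fun i => x (Fin.succ i)) : Fin (m + 1) → F) = x :=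
      Fin.cons_self_tail x
    simpa [q, MeasurableEquiv.piFinSuccAbove, Fin.insertNthEquiv, Fin.removeNth, hc] using hx

end Generic

/-! ### Positive definiteness of sample covariance matrices -/

section Sample

variable {p K : ℕ} {n : Fin (K + 1) → ℕ}

/-- Each outer product contributes the square of a linear form. The index map `g` is arbitrary so
that the formula serves both `sub` and the enumeration `adjoin`. -/
theorem dotProduct_sampleCov_mulVec (D : Data p n) (P : Finset (Fin (K + 1)))
    {J : Type*} [Fintype J] (g : J → Fin p) (y : J → ℝ) :
    y ⬝ᵥ ((sampleCov D P).submatrix g g *ᵥ y)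
      = ((∑ k ∈ P, n k : ℕ) : ℝ)⁻¹ * ∑ k ∈ P, ∑ j, (∑ z, y z * D k j (g z)) ^ 2 := by
  have h : (sampleCov D P).submatrix g g = ((∑ k ∈ P, n k : ℕ) : ℝ)⁻¹ •
      ∑ k ∈ P, ∑ j, Matrix.vecMulVec (D k j ∘ g) (D k j ∘ g) := by
    ext a b
    simp [sampleCov, Matrix.sum_apply, Matrix.vecMulVec_apply]
  rw [h, Matrix.smul_mulVec, dotProduct_smul, smul_eq_mul, Matrix.sum_mulVec, dotProduct_sum]
  congr 1
  refine Finset.sum_congr rfl fun k _ => ?_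
  rw [Matrix.sum_mulVec, dotProduct_sum]
  refine Finset.sum_congr rfl fun j _ => ?_
  rw [Matrix.vecMulVec_mulVec, sq]
  simp only [dotProduct_smul, MulOpposite.smul_eq_mul_unop, MulOpposite.unop_op]
  simp only [dotProduct, Function.comp_apply]
  congr 1
  exact Finset.sum_congr rfl fun z _ => mul_comm _ _

theorem isHermitian_sampleCov (D : Data p n) (P : Finset (Fin (K + 1))) :
    (sampleCov D P).IsHermitian := by
  ext a b
  simp [sampleCov, Matrix.sum_apply, Matrix.vecMulVec_apply, mul_comm]

/-- If some of the observations, restricted to `A`, form a basis, then the marginal sample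
covariance matrix is positive definite. -/
theorem posDef_sub_sampleCov (D : Data p n) (P : Finset (Fin (K + 1))) (A : Finset (Fin p))
    (hA : A.Nonempty) (e : Fin A.card → (k : Fin (K + 1)) × Fin (n k)) (he : ∀ t, (e t).1 ∈ P)
    (hli : LinearIndependent ℝ fun t => fun a : A => D (e t).1 (e t).2 a) :
    (sub (sampleCov D P) A).PosDef := by
  refine Matrix.PosDef.of_dotProduct_mulVec_pos ((isHermitian_sampleCov D P).submatrix _) ?_
  intro y hy
  rw [star_trivial, sub, dotProduct_sampleCov_mulVec]
  have : Nonempty (Fin A.card) := ⟨⟨0, hA.card_pos⟩⟩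
  have hspan := hli.span_eq_top_of_card_eq_finrank (by simp)
  -- Otherwise `y` would be orthogonal to a spanning set, hence to itself.
  obtain ⟨t, ht⟩ : ∃ t, ∑ a : A, y a * D (e t).1 (e t).2 a ≠ 0 := by
    by_contra! h
    have hker : (⊤ : Submodule ℝ (A → ℝ)) ≤ LinearMap.ker (dotProductBilin ℝ ℝ y) := by
      rw [← hspan, Submodule.span_le]
      rintro _ ⟨t, rfl⟩
      exact h t
    have := hker (show y ∈ ⊤ from trivial)
    exact hy (dotProduct_self_eq_zero.1 this)
  have hn : 0 < ∑ k ∈ P, n k :=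
    lt_of_lt_of_le (Fin.pos (e t).2) (Finset.single_le_sum (f := n) (fun _ _ => Nat.zero_le _) (he t))
  have hn' : (0 : ℝ) < (∑ k ∈ P, n k : ℕ) := by exact_mod_cast hn
  refine mul_pos (inv_pos.2 hn') ?_
  refine Finset.sum_pos' (fun k _ => Finset.sum_nonneg fun j _ => sq_nonneg _) ⟨_, he t, ?_⟩
  exact Finset.sum_pos' (fun j _ => sq_nonneg _) ⟨(e t).2, Finset.mem_univ _, by positivity⟩

/-- Injectivity keeps the selected observations independent. -/
theorem exists_injective_observations (P : Finset (Fin (K + 1))) (m : ℕ)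
    (hm : m ≤ ∑ k ∈ P, n k) :
    ∃ e : Fin m → (k : Fin (K + 1)) × Fin (n k), Function.Injective e ∧ ∀ t, (e t).1 ∈ P := by
  let T : Finset ((k : Fin (K + 1)) × Fin (n k)) := P.sigma fun k => Finset.univ
  have hT : T.card = ∑ k ∈ P, n k := by simp [T]
  let f : Fin T.card ≃ T := T.equivFin.symm
  refine ⟨fun t => f (Fin.castLE (hm.trans hT.ge) t), ?_, fun t => ?_⟩
  · exact Subtype.val_injective.comp (f.injective.comp (Fin.castLE_injective _))
  · exact (Finset.mem_sigma.1 (f (Fin.castLE (hm.trans hT.ge) t)).2).1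

/-- By independence, `|A|` distinct observations have a product law with absolutely continuous
factors, so their restrictions to `A` almost surely form a basis. -/
theorem ae_posDef_sub_sampleCov {Ω : Type*} [MeasurableSpace Ω] {μ : Measure Ω}
    [IsProbabilityMeasure μ] {S : Fin (K + 1) → Matrix (Fin p) (Fin p) ℝ} {X : Ω → Data p n}
    (hX : IsGaussianSample μ S X) (P : Finset (Fin (K + 1))) (A : Finset (Fin p))
    (hA : A.Nonempty) (hP : A.card ≤ ∑ k ∈ P, n k) :
    ∀ᵐ w ∂μ, (sub (sampleCov (X w) P) A).PosDef := by
  obtain ⟨e, hinj, he⟩ := exists_injective_observations P A.card hP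
  have hmeas : ∀ t, AEMeasurable (fun w => X w (e t).1 (e t).2) μ :=
    fun t => (hX.1 _ _).aemeasurable
  have hmap := (iIndepFun_iff_map_fun_eq_pi_map hmeas).1 (hX.2.precomp hinj)
  have hprob : ∀ t, IsProbabilityMeasure (μ.map fun w => X w (e t).1 (e t).2) :=
    fun t => Measure.isProbabilityMeasure_map (hmeas t)
  have hac : ∀ t, (μ.map fun w => X w (e t).1 (e t).2) ≪ volume := fun t => by
    rw [(hX.1 _ _).map_eq]
    exact withDensity_absolutelyContinuous _ _
  let L : (Fin p → ℝ) →L[ℝ] (A → ℝ) := ContinuousLinearMap.pi fun a => ContinuousLinearMap.proj a.1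
  have hL : Function.Surjective L := fun y =>
    ⟨fun b => if h : b ∈ A then y ⟨b, h⟩ else 0, by ext a; simp [L]⟩
  have hae := ae_linearIndependent_pi volume L hL A.card _ hac (by simp)
  rw [← hmap] at hae
  filter_upwards [ae_of_ae_map (aemeasurable_pi_lambda _ hmeas) hae] with w hw
  exact posDef_sub_sampleCov (X w) P A hA e he hw

theorem ae_familyCovPosDef (G : Digraph (Fin p)) (I : Fin (K + 1) → Finset (Fin p))
    {Ω : Type*} [MeasurableSpace Ω] {μ : Measure Ω}
    [IsProbabilityMeasure μ] {S : Fin (K + 1) → Matrix (Fin p) (Fin p) ℝ} {X : Ω → Data p n}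
    (hX : IsGaussianSample μ S X)
    (h₀ : ∀ i, (fa G i).card ≤ ∑ k ∈ (targeting I i)ᶜ, n k)
    (h₁ : ∀ i, ∀ k ∈ targeting I i, (fa G i).card ≤ n k) :
    ∀ᵐ w ∂μ, FamilyCovPosDef G I (X w) := by
  have hne : ∀ i, (fa G i).Nonempty := fun i => ⟨i, Finset.mem_insert_self _ _⟩
  simp only [FamilyCovPosDef, ae_all_iff, Filter.eventually_and]
  refine fun i => ⟨ae_posDef_sub_sampleCov hX _ _ (hne i) (h₀ i), fun k hk => ?_⟩
  exact ae_posDef_sub_sampleCov hX _ _ (hne i) (by simpa using h₁ i k hk)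

end Sample

/-! ### Schur complements and linear regression -/

section Schur

variable {p : ℕ}

/-- The enumeration of `insert i A` by `A ⊕ Unit`. -/
def adjoin (A : Finset (Fin p)) (i : Fin p) : A ⊕ Unit → Fin p :=
  Sum.elim Subtype.val fun _ => i

theorem adjoin_injective {A : Finset (Fin p)} {i : Fin p} (hi : i ∉ A) :
    Function.Injective (adjoin A i) :=
  Subtype.val_injective.sumElim (Function.injective_of_subsingleton _)
    fun a _ h => hi (h ▸ a.2)

/-- The bijection between `A ⊕ Unit` and `insert i A`. -/
noncomputable def adjoinEquiv {A : Finset (Fin p)} {i : Fin p} (hi : i ∉ A) :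
    A ⊕ Unit ≃ (insert i A : Finset (Fin p)) :=
  Equiv.ofBijective
    (fun z => ⟨adjoin A i z, by
      rcases z with a | u
      · exact Finset.mem_insert_of_mem a.2
      · exact Finset.mem_insert_self _ _⟩)
    ⟨fun _ _ h => adjoin_injective hi (Subtype.ext_iff.1 h), by
      rintro ⟨b, hb⟩
      rcases Finset.mem_insert.1 hb with rfl | h
      · exact ⟨Sum.inr (), rfl⟩
      · exact ⟨Sum.inl ⟨b, h⟩, rfl⟩⟩

theorem sub_submatrix_adjoinEquiv (S : Matrix (Fin p) (Fin p) ℝ) {A : Finset (Fin p)}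
    {i : Fin p} (hi : i ∉ A) :
    (sub S (insert i A)).submatrix (adjoinEquiv hi) (adjoinEquiv hi)
      = S.submatrix (adjoin A i) (adjoin A i) := rfl

theorem det_sub_insert (S : Matrix (Fin p) (Fin p) ℝ) {A : Finset (Fin p)}
    {i : Fin p} (hi : i ∉ A) :
    (sub S (insert i A)).det = (S.submatrix (adjoin A i) (adjoin A i)).det := by
  rw [← sub_submatrix_adjoinEquiv S hi, Matrix.det_submatrix_equiv_self]

theorem posDef_sub_of_subset {S : Matrix (Fin p) (Fin p) ℝ} {A A' : Finset (Fin p)}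
    (h : (sub S A').PosDef) (hA : A ⊆ A') : (sub S A).PosDef :=
  h.submatrix (e := fun a : A => (⟨a.1, hA a.2⟩ : A')) fun a b hab => by
    exact Subtype.ext (congrArg (fun c : A' => c.1) hab)

/-- The residual variance of the regression of coordinate `i` on the coordinates in `A`. -/
noncomputable def residualVariance (S : Matrix (Fin p) (Fin p) ℝ) (A : Finset (Fin p)) (i : Fin p) : ℝ :=
  (sub S (insert i A)).det / (sub S A).det

theorem residualVariance_pos {S : Matrix (Fin p) (Fin p) ℝ} {A : Finset (Fin p)} {i : Fin p}
    (h : (sub S (insert i A)).PosDef) : 0 < residualVariance S A i :=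
  div_pos h.det_pos (posDef_sub_of_subset h (Finset.subset_insert _ _)).det_pos

/-- Completing the square in a linear regression. -/
theorem exists_quadraticForm_adjoin_eq {S : Matrix (Fin p) (Fin p) ℝ} {A : Finset (Fin p)}
    {i : Fin p} (hi : i ∉ A) (h : (sub S (insert i A)).PosDef) :
    ∃ c : A → ℝ, ∀ y : A → ℝ,
      Sum.elim y (fun _ => 1) ⬝ᵥ
          (S.submatrix (adjoin A i) (adjoin A i) *ᵥ Sum.elim y fun _ => 1)
        = (y + c) ⬝ᵥ (sub S A *ᵥ (y + c)) + residualVariance S A i := by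
  have hA := posDef_sub_of_subset h (Finset.subset_insert i A)
  set M := S.submatrix (adjoin A i) (adjoin A i) with hM
  have hMpd : M.PosDef := by
    rw [hM, ← sub_submatrix_adjoinEquiv S hi]
    exact h.submatrix (adjoinEquiv hi).injective
  have h11 : M.toBlocks₁₁ = sub S A := rfl
  have h21 : M.toBlocks₂₁ = M.toBlocks₁₂ᴴ := by
    ext a b
    exact (hMpd.isHermitian.apply _ _).symm
  have hfb : M = Matrix.fromBlocks (sub S A) M.toBlocks₁₂ M.toBlocks₁₂ᴴ M.toBlocks₂₂ := by
    rw [← h11, ← h21, Matrix.fromBlocks_toBlocks]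
  let : Invertible (sub S A) := hA.isUnit.invertible
  set R := M.toBlocks₂₂ - M.toBlocks₁₂ᴴ * (sub S A)⁻¹ * M.toBlocks₁₂ with hR
  -- The Schur complement is a `1 × 1` matrix, so its entry is the quotient of the two determinants.
  have hdet : R () () = residualVariance S A i := by
    have : M.det = (sub S A).det * R.det := by
      conv_lhs => rw [hfb]
      rw [Matrix.det_fromBlocks₁₁, hR, Matrix.invOf_eq_nonsing_inv]
    rw [residualVariance, det_sub_insert S hi, this, mul_div_cancel_left₀ _ hA.det_pos.ne',
      Matrix.det_unique]
  -- The shift `c` is the vector of least-squares coefficients; the form is minimal at `y = -c`.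
  refine ⟨((sub S A)⁻¹ * M.toBlocks₁₂) *ᵥ fun _ => 1, fun y => ?_⟩
  have key := Matrix.schur_complement_eq₁₁ M.toBlocks₁₂ M.toBlocks₂₂ y (fun _ => 1)
    hA.isHermitian
  rw [← hfb, ← hR] at key
  simp only [star_trivial, ← Matrix.dotProduct_mulVec] at key
  rw [key, ← hdet]
  simp [dotProduct, Matrix.mulVec]

end Schur

/-! ### The pooled terms of the data vector -/

section Alpha

variable {p K : ℕ} {n : Fin (K + 1) → ℕ}

theorem dotProduct_fill_mulVec (A : Finset (Fin p)) (M : Matrix A A ℝ) (x : Fin p → ℝ) :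
    x ⬝ᵥ (fill A M *ᵥ x) = ∑ a : A, ∑ b : A, M a b * (x b * x a) := by
  have h : ∀ f : Fin p → ℝ, (∀ a, a ∉ A → f a = 0) → ∑ a, f a = ∑ a : A, f a := by
    intro f hf
    rw [Finset.sum_coe_sort A f]
    exact (Finset.sum_subset (Finset.subset_univ A) fun a _ ha => hf a ha).symm
  simp only [dotProduct, Matrix.mulVec]
  rw [h _ fun a ha => by simp [fill, ha]]
  refine Finset.sum_congr rfl fun a _ => ?_
  rw [h _ fun b hb => by simp [fill, hb], Finset.mul_sum]
  refine Finset.sum_congr rfl fun b _ => ?_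
  simp [fill]
  ring

/-- Pooling turns the sum of the quadratic forms into `N` times the trace of `S_A⁻¹ S_A`, which is
`N |A|`. -/
theorem sum_alphaTerm {D : Data p n} {P : Finset (Fin (K + 1))} {A : Finset (Fin p)}
    (hn : 0 < ∑ k ∈ P, n k) (h : (sub (sampleCov D P) A).PosDef) :
    ∑ k ∈ P, alphaTerm D (sampleCov D P) A k
      = ((∑ k ∈ P, n k : ℕ) : ℝ) / 2 * (A.card + Real.log (sub (sampleCov D P) A).det) := by
  set N : ℝ := ((∑ k ∈ P, n k : ℕ) : ℝ) with hN
  have hN0 : N ≠ 0 := by rw [hN]; exact_mod_cast hn.ne'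
  set M := sub (sampleCov D P) A with hM
  have hS : ∀ a b : A, ∑ k ∈ P, ∑ j, D k j b * D k j a = N * M b a := by
    intro a b
    simp [hM, sub, sampleCov, Matrix.sum_apply, Matrix.vecMulVec_apply, ← hN]
    rw [mul_inv_cancel_left₀ (by simpa [hN] using hN0)]
  have hquad : ∑ k ∈ P, ∑ j, D k j ⬝ᵥ (fill A M⁻¹ *ᵥ D k j) = N * A.card := by
    simp only [dotProduct_fill_mulVec]
    calc ∑ k ∈ P, ∑ j, ∑ a : A, ∑ b : A, M⁻¹ a b * (D k j b * D k j a)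
        = ∑ a : A, ∑ b : A, M⁻¹ a b * ∑ k ∈ P, ∑ j, D k j b * D k j a := by
          simp only [Finset.mul_sum]
          rw [Finset.sum_congr rfl fun k _ => Finset.sum_comm, Finset.sum_comm]
          refine Finset.sum_congr rfl fun a _ => ?_
          rw [Finset.sum_congr rfl fun k _ => Finset.sum_comm, Finset.sum_comm]
      _ = N * (M⁻¹ * M).trace := by
          simp only [hS, Matrix.trace, Matrix.diag, Matrix.mul_apply, Finset.mul_sum]
          exact Finset.sum_congr rfl fun a _ => Finset.sum_congr rfl fun b _ => by ring
      _ = N * A.card := by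
          rw [Matrix.nonsing_inv_mul _ ((Matrix.isUnit_iff_isUnit_det _).1 h.isUnit)]
          simp
  simp only [alphaTerm, Finset.sum_add_distrib, ← Finset.mul_sum, ← Finset.sum_mul, ← hM]
  rw [hquad, ← Finset.sum_div, ← Nat.cast_sum, ← hN]
  ring

end Alpha

/-! ### Maximising the likelihood of a single node -/

section NodeLikelihood

variable {p K : ℕ} {n : Fin (K + 1) → ℕ}

/-- The contribution of node `i` in the experiments `P` to the log-likelihood, up to the
constant that involves `2π`, if these experiments share the parameters `(b, w)` of the node. -/
noncomputable def nodeLogLik (D : Data p n) (P : Finset (Fin (K + 1))) (i : Fin p) (b : Fin p → ℝ) (w : ℝ) :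
    ℝ :=
  ∑ k ∈ P, ∑ j, -(1 / 2) * (Real.log w + (D k j i - b ⬝ᵥ D k j) ^ 2 / w)

/-- The maximum of `nodeLogLik`. -/
noncomputable def maxNodeLogLik (D : Data p n) (P : Finset (Fin (K + 1))) (A : Finset (Fin p)) (i : Fin p) :
    ℝ :=
  -(((∑ k ∈ P, n k : ℕ) : ℝ) / 2 * (Real.log (residualVariance (sampleCov D P) A i) + 1))

/-- The residual `x i - b ⬝ᵥ x` is the linear form with coefficients `(-b, 1)` on `A ⊕ Unit`, so the
residual sum of squares is `N` times a quadratic form of the sample covariance. -/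
theorem nodeLogLik_eq (D : Data p n) {P : Finset (Fin (K + 1))} {A : Finset (Fin p)} {i : Fin p}
    (hn : 0 < ∑ k ∈ P, n k) {b : Fin p → ℝ} (hb : ∀ j, j ∉ A → b j = 0) (w : ℝ) :
    nodeLogLik D P i b w = -(((∑ k ∈ P, n k : ℕ) : ℝ) / 2 * (Real.log w +
      Sum.elim (fun a : A => -b a) (fun _ => 1) ⬝ᵥ
        ((sampleCov D P).submatrix (adjoin A i) (adjoin A i) *ᵥ
          Sum.elim (fun a : A => -b a) fun _ => 1) / w)) := by
  rw [dotProduct_sampleCov_mulVec]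
  set N : ℝ := ((∑ k ∈ P, n k : ℕ) : ℝ) with hN
  have hN0 : N ≠ 0 := by rw [hN]; exact_mod_cast hn.ne'
  have hres : ∀ x : Fin p → ℝ,
      ∑ z, Sum.elim (fun a : A => -b a) (fun _ => (1 : ℝ)) z * x (adjoin A i z)
        = x i - b ⬝ᵥ x := by
    intro x
    have : b ⬝ᵥ x = ∑ a : A, b a * x a := by
      rw [Finset.sum_coe_sort A fun a => b a * x a]
      exact (Finset.sum_subset (Finset.subset_univ A) fun a _ ha => by simp [hb a ha]).symm
    simp [adjoin, Fintype.sum_sum_type, this]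
    ring
  simp only [hres, nodeLogLik]
  simp only [← Finset.mul_sum, Finset.sum_add_distrib, ← Finset.sum_div, Finset.sum_const,
    Finset.card_univ, Fintype.card_fin, nsmul_eq_mul, ← Finset.sum_mul]
  rw [← Nat.cast_sum, ← hN]
  field_simp

/-- This is `log t ≤ t - 1` at `t = s / w`. Equality holds for `q = w = s`, so the bound is
attained. -/
theorem log_add_one_le_log_add_div {s q w : ℝ} (hs : 0 < s) (hw : 0 < w) (hq : s ≤ q) :
    Real.log s + 1 ≤ Real.log w + q / w := by
  have h1 : Real.log (s / w) ≤ s / w - 1 := Real.log_le_sub_one_of_pos (div_pos hs hw)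
  rw [Real.log_div hs.ne' hw.ne'] at h1
  have h2 : s / w ≤ q / w := by gcongr
  linarith

theorem nodeLogLik_le {D : Data p n} {P : Finset (Fin (K + 1))} {A : Finset (Fin p)} {i : Fin p}
    (hi : i ∉ A) (hn : 0 < ∑ k ∈ P, n k) (h : (sub (sampleCov D P) (insert i A)).PosDef)
    {b : Fin p → ℝ} (hb : ∀ j, j ∉ A → b j = 0) {w : ℝ} (hw : 0 < w) :
    nodeLogLik D P i b w ≤ maxNodeLogLik D P A i := by
  obtain ⟨c, hc⟩ := exists_quadraticForm_adjoin_eq hi h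
  rw [nodeLogLik_eq D hn hb, maxNodeLogLik, hc, neg_le_neg_iff]
  refine mul_le_mul_of_nonneg_left ?_ (by positivity)
  refine log_add_one_le_log_add_div (residualVariance_pos h) hw ?_
  have := (posDef_sub_of_subset h (Finset.subset_insert i A)).posSemidef.dotProduct_mulVec_nonneg
    ((fun a : A => -b a) + c)
  rw [star_trivial] at this
  linarith

theorem exists_nodeLogLik_eq_max {D : Data p n} {P : Finset (Fin (K + 1))} {A : Finset (Fin p)}
    {i : Fin p} (hi : i ∉ A) (hn : 0 < ∑ k ∈ P, n k)
    (h : (sub (sampleCov D P) (insert i A)).PosDef) :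
    ∃ b : Fin p → ℝ, ∃ w : ℝ, (∀ j, j ∉ A → b j = 0) ∧ 0 < w ∧
      nodeLogLik D P i b w = maxNodeLogLik D P A i := by
  obtain ⟨c, hc⟩ := exists_quadraticForm_adjoin_eq hi h
  have hs := residualVariance_pos h
  -- With these least-squares coefficients the completed square vanishes.
  refine ⟨fun a => if ha : a ∈ A then c ⟨a, ha⟩ else 0, residualVariance (sampleCov D P) A i,
    fun j hj => by simp [hj], hs, ?_⟩
  rw [nodeLogLik_eq D hn (A := A) (fun j hj => by simp [hj]), maxNodeLogLik, hc]
  have h0 : (fun a : A => -(if ha : a.1 ∈ A then c ⟨a, ha⟩ else 0)) + c = 0 := by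
    ext a
    simp
  rw [h0]
  simp [div_self hs.ne']

/-- An empty pool has sample covariance `0` (as `0⁻¹ = 0`), which has no positive diagonal entry.
Thus positive definiteness already supplies the observations needed for division by `N`. -/
theorem sum_pos_of_posDef_sub_sampleCov {D : Data p n} {P : Finset (Fin (K + 1))}
    {A : Finset (Fin p)} (hA : A.Nonempty) (h : (sub (sampleCov D P) A).PosDef) :
    0 < ∑ k ∈ P, n k := by
  rw [Nat.pos_iff_ne_zero]
  intro h0
  obtain ⟨a, ha⟩ := hA
  have := h.diag_pos (i := ⟨a, ha⟩)
  simp [sub, sampleCov, h0] at this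

end NodeLikelihood

/-! ### Counting the free parameters -/

section Dimension

variable {p K : ℕ}

theorem mem_pa {V : Type*} [Fintype V] {G : Digraph V} {v w : V} : w ∈ pa G v ↔ G.Adj w v := by
  simp [pa]

theorem mem_targeting {I : Fin (K + 1) → Finset (Fin p)} {i : Fin p} {k : Fin (K + 1)} :
    k ∈ targeting I i ↔ i ∈ I k := by
  simp [targeting]

theorem zero_notMem_targeting {I : Fin (K + 1) → Finset (Fin p)} (hI : I 0 = ∅) (i : Fin p) :
    0 ∉ targeting I i := by
  simp [mem_targeting, hI]

/-- The free coordinates of a parameter vector. -/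
def freeCoordinates (G : Digraph (Fin p)) (I : Fin (K + 1) → Finset (Fin p)) :
    paramSubmodule G I →ₗ[ℝ]
      ((Σ i, (insert 0 (targeting I i) : Finset (Fin (K + 1))) × (pa G i : Finset (Fin p))) → ℝ) ×
      ((Σ i, (insert 0 (targeting I i) : Finset (Fin (K + 1)))) → ℝ) where
  toFun θ := (fun s => θ.1.1 s.2.1 s.1 s.2.2, fun s => θ.1.2 s.2 s.1)
  map_add' _ _ := rfl
  map_smul' _ _ := rfl

theorem freeCoordinates_injective (G : Digraph (Fin p)) (I : Fin (K + 1) → Finset (Fin p)) :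
    Function.Injective (freeCoordinates G I) := by
  rw [← LinearMap.ker_eq_bot, LinearMap.ker_eq_bot']
  rintro ⟨⟨B, ω⟩, hB, hBω⟩ h
  have h1 := congrFun (congrArg Prod.fst h)
  have h2 := congrFun (congrArg Prod.snd h)
  have hB' : ∀ i k, k ∈ insert 0 (targeting I i) → ∀ j, B k i j = 0 := by
    intro i k hk j
    by_cases hj : j ∈ pa G i
    · exact h1 ⟨i, ⟨k, hk⟩, ⟨j, hj⟩⟩
    · exact hB k i j fun h => hj (mem_pa.2 h)
  have hω' : ∀ i k, k ∈ insert 0 (targeting I i) → ω k i = 0 := fun i k hk => h2 ⟨i, ⟨k, hk⟩⟩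
  have hz : ∀ i, 0 ∈ insert 0 (targeting I i) := fun i => Finset.mem_insert_self _ _
  refine Subtype.ext (Prod.ext ?_ ?_)
  · ext k i j
    by_cases hk : i ∈ I k
    · exact hB' i k (Finset.mem_insert_of_mem (mem_targeting.2 hk)) j
    · exact ((hBω k i hk).1 j).trans (hB' i 0 (hz i) j)
  · ext k i
    by_cases hk : i ∈ I k
    · exact hω' i k (Finset.mem_insert_of_mem (mem_targeting.2 hk))
    · exact (hBω k i hk).2.trans (hω' i 0 (hz i))

theorem freeCoordinates_surjective (G : Digraph (Fin p)) {I : Fin (K + 1) → Finset (Fin p)}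
    (hI : I 0 = ∅) : Function.Surjective (freeCoordinates G I) := by
  rintro ⟨f, g⟩
  have hz : ∀ i, 0 ∈ insert 0 (targeting I i) := fun i => Finset.mem_insert_self _ _
  have ht : ∀ i k, i ∈ I k → k ∈ insert 0 (targeting I i) := fun i k h =>
    Finset.mem_insert_of_mem (mem_targeting.2 h)
  have h0 : ∀ i, i ∉ I 0 := fun i => by simp [hI]
  -- Index `0` carries the shared observational parameters, copied to every experiment that does not
  -- target `i`.
  refine ⟨⟨(fun k i j => if hj : j ∈ pa G i then
      if hk : i ∈ I k then f ⟨i, ⟨k, ht i k hk⟩, ⟨j, hj⟩⟩ else f ⟨i, ⟨0, hz i⟩, ⟨j, hj⟩⟩ else 0,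
    fun k i => if hk : i ∈ I k then g ⟨i, ⟨k, ht i k hk⟩⟩ else g ⟨i, ⟨0, hz i⟩⟩),
    fun k i j h => ?_, fun k i h => ⟨fun j => ?_, ?_⟩⟩, ?_⟩
  · simp [mem_pa, h]
  · simp [h, h0]
  · simp [h, h0]
  · refine Prod.ext ?_ ?_
    · ext ⟨i, ⟨k, hk⟩, ⟨j, hj⟩⟩
      rcases Finset.mem_insert.1 hk with rfl | hk'
      · exact (dif_pos hj).trans (dif_neg (h0 i))
      · exact (dif_pos hj).trans (dif_pos (mem_targeting.1 hk'))
    · ext ⟨i, ⟨k, hk⟩⟩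
      rcases Finset.mem_insert.1 hk with rfl | hk'
      · exact dif_neg (h0 i)
      · exact dif_pos (mem_targeting.1 hk')

/-- Node `i` has one variance and `|pa(i)|` coefficients for each index in `{0} ∪ Z_i`; the union is
disjoint because `I 0 = ∅`. -/
theorem numFreeParams_eq (G : Digraph (Fin p)) {I : Fin (K + 1) → Finset (Fin p)}
    (hI : I 0 = ∅) :
    numFreeParams G I = ∑ i, (1 + (targeting I i).card) * (1 + (pa G i).card) := by
  rw [numFreeParams, (LinearEquiv.ofBijective (freeCoordinates G I)
    ⟨freeCoordinates_injective G I, freeCoordinates_surjective G hI⟩).finrank_eq,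
    Module.finrank_prod, Module.finrank_fintype_fun_eq_card,
    Module.finrank_fintype_fun_eq_card, Fintype.card_sigma, Fintype.card_sigma,
    ← Finset.sum_add_distrib]
  refine Finset.sum_congr rfl fun i _ => ?_
  rw [Fintype.card_prod, Fintype.card_coe, Fintype.card_coe,
    Finset.card_insert_of_notMem (zero_notMem_targeting hI i)]
  ring

theorem sum_card_targeting {I : Fin (K + 1) → Finset (Fin p)} (hI : I 0 = ∅) :
    ∑ i, (targeting I i).card = ∑ k : Fin K, (I k.succ).card := by
  have h : ∑ i, (targeting I i).card = ∑ k, (I k).card := by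
    simp only [targeting, Finset.card_filter, Finset.card_eq_sum_ones (I _)]
    rw [Finset.sum_comm]
    exact Finset.sum_congr rfl fun k _ => by simp
  rw [h, Fin.sum_univ_succ, hI, Finset.card_empty, zero_add]

/-- There is no vertex `z_0`, so the shift by `succ` reaches all of `Z_i` only because `I 0 = ∅`. -/
theorem map_targetingVertices {I : Fin (K + 1) → Finset (Fin p)} (hI : I 0 = ∅) (i : Fin p) :
    (targetingVertices I i).map (Fin.succEmb K) = targeting I i := by
  ext k
  refine Fin.cases ?_ (fun k => ?_) k
  · simp [mem_targeting, hI]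
  · simp [mem_targeting, targetingVertices]

end Dimension

/-! ### Pairing with the standard imset -/

section Imset

theorem sum_mul_standardImset {V : Type*} [Fintype V] [DecidableEq V] (G : Digraph V)
    (α : Finset V → ℝ) :
    ∑ S, α S * (standardImset G S : ℝ)
      = α Finset.univ - α ∅ + ∑ v, (α (pa G v) - α (fa G v)) := by
  have hδ : ∀ A : Finset V, ∑ S, α S * (delta A S : ℝ) = α A := by
    intro A
    simp [delta]
  simp only [standardImset, Pi.add_apply, Pi.sub_apply, Finset.sum_apply, Int.cast_add,
    Int.cast_sub, Int.cast_sum, mul_add, mul_sub, Finset.sum_add_distrib,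
    Finset.sum_sub_distrib, Finset.mul_sum, hδ]
  rw [Finset.sum_comm, Finset.sum_comm (s := Finset.univ) (t := Finset.univ)
    (f := fun S v => α S * (delta (fa G v) S : ℝ))]
  simp only [hδ]

variable {p K : ℕ} (G : Digraph (Fin p)) (I : Fin (K + 1) → Finset (Fin p))

theorem pa_iDAG_inl (i : Fin p) :
    pa (iDAG G I) (Sum.inl i) = (pa G i).disjSum (targetingVertices I i) := by
  ext (a | k) <;> simp [mem_pa, iDAG, targetingVertices]

theorem pa_iDAG_inr (k : Fin K) : pa (iDAG G I) (Sum.inr k) = ∅ := by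
  ext (a | k) <;> simp [mem_pa, iDAG]

theorem fa_iDAG_inl (i : Fin p) :
    fa (iDAG G I) (Sum.inl i) = (fa G i).disjSum (targetingVertices I i) := by
  rw [fa, pa_iDAG_inl, fa]
  ext (a | k) <;> simp

variable {n : Fin (K + 1) → ℕ}

/-- An empty matrix has determinant `1` and quadratic form `0`, and `choose 0 2 = 0`. -/
theorem alphaCoord_empty (D : Data p n) (𝓩 : Finset (Fin K)) : alphaCoord D ∅ 𝓩 = 0 := by
  have h : ∀ S k, alphaTerm D S ∅ k = 0 := by
    intro S k
    simp [alphaTerm, dotProduct_fill_mulVec]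
  simp [alphaCoord, h]

/-- The parent set and the family of `z_k` contain no vertex of `G`, so only the nodes of `G`
contribute to the sum. -/
theorem sum_alphaVec_mul_standardImset (D : Data p n) :
    ∑ S, alphaVec D S * (standardImset (iDAG G I) S : ℝ)
      = alphaVec D Finset.univ - alphaVec D ∅
        + ∑ i, (alphaVec D ((pa G i).disjSum (targetingVertices I i))
          - alphaVec D ((fa G i).disjSum (targetingVertices I i))) := by
  have h₀ : alphaVec D ∅ = 0 := alphaCoord_empty D _
  have h₁ : ∀ k : Fin K, alphaVec D (fa (iDAG G I) (Sum.inr k)) = 0 := by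
    intro k
    have : (fa (iDAG G I) (Sum.inr k)).toLeft = ∅ := by
      ext a
      simp [fa, pa_iDAG_inr]
    rw [alphaVec, this, alphaCoord_empty]
  rw [sum_mul_standardImset, Fintype.sum_sum_type]
  simp [pa_iDAG_inl, fa_iDAG_inl, pa_iDAG_inr, h₀, h₁]

end Imset

/-! ### The maximum likelihood and the BIC -/

section MaximumLikelihood

variable {p K : ℕ} {n : Fin (K + 1) → ℕ} {G : Digraph (Fin p)} {I : Fin (K + 1) → Finset (Fin p)}

theorem likelihood_pos (hG : IsDAG G) (D : Data p n) {θ : ParamVec p K}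
    (hθ : θ ∈ paramSpace G I) : 0 < likelihood D θ :=
  Finset.prod_pos fun k _ => Finset.prod_pos fun _ _ =>
    gaussDensity_covMatrix_pos hG (hθ.1.1 k) (hθ.2 k) _

theorem log_likelihood (hG : IsDAG G) (D : Data p n) {θ : ParamVec p K}
    (hθ : θ ∈ paramSpace G I) :
    Real.log (likelihood D θ) = -∑ k, (p * n k : ℝ) / 2 * Real.log (2 * Real.pi)
      + ∑ i, (nodeLogLik D (targeting I i)ᶜ i (θ.1 0 i) (θ.2 0 i)
        + ∑ k ∈ targeting I i, nodeLogLik D {k} i (θ.1 k i) (θ.2 k i)) := by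
  have hpos : ∀ k j, gaussDensity (covMatrix (θ.1 k) (θ.2 k)) (D k j) ≠ 0 := fun k j =>
    (gaussDensity_covMatrix_pos hG (hθ.1.1 k) (hθ.2 k) _).ne'
  rw [likelihood, Real.log_prod fun k _ => Finset.prod_ne_zero_iff.2 fun j _ => hpos k j]
  simp only [Real.log_prod fun _ _ => hpos _ _]
  simp only [log_gaussDensity_covMatrix hG (hθ.1.1 _) (hθ.2 _), Finset.sum_add_distrib]
  rw [← Finset.sum_neg_distrib, ← Finset.sum_add_distrib (s := Finset.univ (α := Fin p))]
  congr 1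
  · refine Finset.sum_congr rfl fun k _ => ?_
    simp
    ring
  · rw [Finset.sum_congr rfl fun k _ => Finset.sum_comm, Finset.sum_comm]
    refine Finset.sum_congr rfl fun i _ => ?_
    -- Outside `Z_i` the parameters of node `i` are those of experiment `0`, so these experiments
    -- pool into one regression.
    rw [← Finset.sum_compl_add_sum (targeting I i)]
    congr 1
    · refine Finset.sum_congr rfl fun k hk => ?_
      have hk' : i ∉ I k := fun h => (Finset.mem_compl.1 hk) (mem_targeting.2 h)
      rw [show θ.1 k i = θ.1 0 i from funext (hθ.1.2 k i hk').1, (hθ.1.2 k i hk').2]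
    · exact Finset.sum_congr rfl fun k _ => by simp [nodeLogLik]

/-- The maximum of the log-likelihood. -/
noncomputable def maxLogLik (G : Digraph (Fin p)) (I : Fin (K + 1) → Finset (Fin p))
    (D : Data p n) : ℝ :=
  -∑ k, (p * n k : ℝ) / 2 * Real.log (2 * Real.pi)
    + ∑ i, (maxNodeLogLik D (targeting I i)ᶜ (pa G i) i
      + ∑ k ∈ targeting I i, maxNodeLogLik D {k} (pa G i) i)

theorem notMem_pa (hG : IsDAG G) (i : Fin p) : i ∉ pa G i :=
  fun h => hG i (Relation.TransGen.single (mem_pa.1 h))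

theorem log_likelihood_le (hG : IsDAG G) {D : Data p n} (hD : FamilyCovPosDef G I D)
    {θ : ParamVec p K} (hθ : θ ∈ paramSpace G I) :
    Real.log (likelihood D θ) ≤ maxLogLik G I D := by
  have hfa : ∀ i, (fa G i).Nonempty := fun i => ⟨i, Finset.mem_insert_self _ _⟩
  have hb : ∀ k i j, j ∉ pa G i → θ.1 k i j = 0 := fun k i j h =>
    hθ.1.1 k i j fun h' => h (mem_pa.2 h')
  have hle : ∀ k i P, (sub (sampleCov D P) (fa G i)).PosDef →
      nodeLogLik D P i (θ.1 k i) (θ.2 k i) ≤ maxNodeLogLik D P (pa G i) i := fun k i P h =>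
    nodeLogLik_le (notMem_pa hG i) (sum_pos_of_posDef_sub_sampleCov (hfa i) h) h (hb k i)
      (hθ.2 k i)
  rw [log_likelihood hG D hθ, maxLogLik]
  gcongr with i _ k hk
  · exact hle _ _ _ (hD i).1
  · exact hle _ _ _ ((hD i).2 k hk)

theorem exists_log_likelihood_eq (hI : I 0 = ∅) (hG : IsDAG G) {D : Data p n}
    (hD : FamilyCovPosDef G I D) :
    ∃ θ ∈ paramSpace G I, Real.log (likelihood D θ) = maxLogLik G I D := by
  have hfa : ∀ i, (fa G i).Nonempty := fun i => ⟨i, Finset.mem_insert_self _ _⟩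
  -- `P k i` is the pool of experiments sharing the parameters of node `i` with experiment `k`.
  let P : Fin (K + 1) → Fin p → Finset (Fin (K + 1)) := fun k i =>
    if i ∈ I k then {k} else (targeting I i)ᶜ
  have hP : ∀ k i, (sub (sampleCov D (P k i)) (fa G i)).PosDef := by
    intro k i
    by_cases hk : i ∈ I k
    · simpa [P, hk] using (hD i).2 k (mem_targeting.2 hk)
    · simpa [P, hk] using (hD i).1
  -- Choosing the optimum as a function of the pool makes the invariance constraints automatic:
  -- equal pools give equal parameters. Pools without positive definiteness get a dummy value.
  have hex : ∀ i (Q : Finset (Fin (K + 1))), ∃ b : Fin p → ℝ, ∃ w : ℝ,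
      (sub (sampleCov D Q) (fa G i)).PosDef → (∀ j, j ∉ pa G i → b j = 0) ∧ 0 < w ∧
        nodeLogLik D Q i b w = maxNodeLogLik D Q (pa G i) i := by
    intro i Q
    by_cases h : (sub (sampleCov D Q) (fa G i)).PosDef
    · obtain ⟨b, w, hbw⟩ := exists_nodeLogLik_eq_max (notMem_pa hG i)
        (sum_pos_of_posDef_sub_sampleCov (hfa i) h) h
      exact ⟨b, w, fun _ => hbw⟩
    · exact ⟨0, 0, fun h' => absurd h' h⟩
  choose b w hbw using hex
  have h0 : ∀ i, i ∉ I 0 := fun i => by simp [hI]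
  have hP0 : ∀ i, P 0 i = (targeting I i)ᶜ := fun i => by simp [P, h0 i]
  have hPk : ∀ k i, i ∉ I k → P k i = P 0 i := fun k i hk => by simp [P, hk, h0 i]
  have hθ : ((fun k i j => b i (P k i) j, fun k i => w i (P k i)) : ParamVec p K)
      ∈ paramSpace G I := by
    refine ⟨⟨fun k i j h => ?_, fun k i h => ⟨fun j => ?_, ?_⟩⟩, fun k i => ?_⟩
    · exact (hbw i _ (hP k i)).1 j fun h' => h (mem_pa.1 h')
    · simp only [hPk k i h]
    · simp only [hPk k i h]
    · exact (hbw i _ (hP k i)).2.1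
  refine ⟨_, hθ, ?_⟩
  rw [log_likelihood hG D hθ, maxLogLik]
  congr 1
  refine Finset.sum_congr rfl fun i _ => ?_
  congr 1
  · have := (hbw i _ (hP 0 i)).2.2
    change nodeLogLik D _ i (b i (P 0 i)) (w i (P 0 i)) = _
    rwa [hP0] at this ⊢
  · refine Finset.sum_congr rfl fun k hk => ?_
    have hPk' : P k i = {k} := by simp [P, mem_targeting.1 hk]
    have := (hbw i _ (hP k i)).2.2
    change nodeLogLik D _ i (b i (P k i)) (w i (P k i)) = _
    rwa [hPk'] at this ⊢

theorem exists_isMLE (hI : I 0 = ∅) (hG : IsDAG G) {D : Data p n}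
    (hD : FamilyCovPosDef G I D) : ∃ θ, IsMLE G I D θ := by
  obtain ⟨θ, hθ, h⟩ := exists_log_likelihood_eq hI hG hD
  refine ⟨θ, hθ, fun θ' hθ' => ?_⟩
  rw [← Real.log_le_log_iff (likelihood_pos hG D hθ') (likelihood_pos hG D hθ), h]
  exact log_likelihood_le hG hD hθ'

/-- The upper bound is attained inside the parameter space, so every maximiser has this value;
uniqueness is not needed. -/
theorem IsMLE.log_likelihood_eq (hI : I 0 = ∅) (hG : IsDAG G) {D : Data p n}
    (hD : FamilyCovPosDef G I D) {θ : ParamVec p K} (hθ : IsMLE G I D θ) :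
    Real.log (likelihood D θ) = maxLogLik G I D := by
  obtain ⟨θ', hθ', h⟩ := exists_log_likelihood_eq hI hG hD
  refine le_antisymm (log_likelihood_le hG hD hθ.1) ?_
  rw [← h]
  exact Real.log_le_log (likelihood_pos hG D hθ') (hθ.2 θ' hθ')

/-- The cardinalities differ by one, which gives the `+ 1`, and the log-determinants differ by the
log of the residual variance. -/
theorem sum_alphaTerm_pa_sub_fa (hG : IsDAG G) {D : Data p n} {P : Finset (Fin (K + 1))}
    {i : Fin p} (h : (sub (sampleCov D P) (fa G i)).PosDef) :
    ∑ k ∈ P, alphaTerm D (sampleCov D P) (pa G i) k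
        - ∑ k ∈ P, alphaTerm D (sampleCov D P) (fa G i) k
      = maxNodeLogLik D P (pa G i) i := by
  have hn := sum_pos_of_posDef_sub_sampleCov ⟨i, Finset.mem_insert_self _ _⟩ h
  have h' := posDef_sub_of_subset h (Finset.subset_insert i (pa G i))
  have hcard : (fa G i).card = (pa G i).card + 1 :=
    Finset.card_insert_of_notMem (notMem_pa hG i)
  rw [sum_alphaTerm hn h, sum_alphaTerm hn h', maxNodeLogLik, residualVariance,
    show insert i (pa G i) = fa G i from rfl,
    Real.log_div h.det_pos.ne' h'.det_pos.ne', hcard]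
  push_cast
  ring

theorem alphaVec_pa_sub_fa (hI : I 0 = ∅) (hG : IsDAG G) {D : Data p n}
    (hD : FamilyCovPosDef G I D) (i : Fin p) :
    alphaVec D ((pa G i).disjSum (targetingVertices I i))
        - alphaVec D ((fa G i).disjSum (targetingVertices I i))
      = maxNodeLogLik D (targeting I i)ᶜ (pa G i) i
        + ∑ k ∈ targeting I i, maxNodeLogLik D {k} (pa G i) i
        - Real.log ((∑ k, n k : ℕ) : ℝ) / 2
          * ((1 + (targeting I i).card) * (pa G i).card) := by
  have hcard : (fa G i).card = (pa G i).card + 1 :=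
    Finset.card_insert_of_notMem (notMem_pa hG i)
  -- Pascal's rule: the binomial penalties differ by the number of edge coefficients at `i`.
  have hchoose : ((fa G i).card.choose 2 : ℝ) = (pa G i).card + ((pa G i).card.choose 2 : ℕ) := by
    rw [hcard, Nat.choose_succ_succ', Nat.choose_one_right]
    push_cast
    rfl
  have h₁ : ∑ k ∈ targeting I i, maxNodeLogLik D {k} (pa G i) i
      = ∑ k ∈ targeting I i, alphaTerm D (sampleCov D {k}) (pa G i) k
        - ∑ k ∈ targeting I i, alphaTerm D (sampleCov D {k}) (fa G i) k := by
    rw [← Finset.sum_sub_distrib]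
    refine Finset.sum_congr rfl fun k hk => ?_
    simpa using (sum_alphaTerm_pa_sub_fa hG ((hD i).2 k hk)).symm
  rw [← sum_alphaTerm_pa_sub_fa hG (hD i).1, h₁]
  simp only [alphaVec, alphaCoord, Finset.toLeft_disjSum, Finset.toRight_disjSum,
    map_targetingVertices hI, Finset.sum_const, nsmul_eq_mul, hchoose]
  ring

theorem IsMLE.bic_eq (hI : I 0 = ∅) (hG : IsDAG G) {D : Data p n}
    (hD : FamilyCovPosDef G I D) {θ : ParamVec p K} (hθ : IsMLE G I D θ) :
    bic G I D θ = constC n I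
      + ∑ i, (alphaVec D ((pa G i).disjSum (targetingVertices I i))
        - alphaVec D ((fa G i).disjSum (targetingVertices I i))) := by
  have hsum : (∑ k : Fin K, ((I k.succ).card : ℝ)) = ∑ i, ((targeting I i).card : ℝ) := by
    exact_mod_cast (sum_card_targeting hI).symm
  rw [bic, hθ.log_likelihood_eq hI hG hD, maxLogLik, numFreeParams_eq G hI, constC, hsum]
  simp only [alphaVec_pa_sub_fa hI hG hD, Finset.sum_sub_distrib, ← Finset.mul_sum]
  -- The variances, `p + ∑ |Z_i|` in number, go into `C`; the edge coefficients are accounted for by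
  -- `α`.
  have : ((∑ i, (1 + (targeting I i).card) * (1 + (pa G i).card) : ℕ) : ℝ)
      = p + ∑ i, ((targeting I i).card : ℝ)
        + ∑ i, ((1 + (targeting I i).card : ℝ) * (pa G i).card) := by
    push_cast
    simp only [mul_add, mul_one, Finset.sum_add_distrib]
    simp
  rw [this]
  ring

end MaximumLikelihood

end GaussianIDAG

theorem mainTheorem6 {p K : ℕ} (I : Fin (K + 1) → Finset (Fin p)) (hI : I 0 = ∅)
    (G : Digraph (Fin p)) (hG : GaussianIDAG.IsDAG G) (n : Fin (K + 1) → ℕ) :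
    -- for every data set for which the relevant sample covariance matrices are positive definite
    (∀ D : GaussianIDAG.Data p n, GaussianIDAG.FamilyCovPosDef G I D →
      -- the maximum likelihood estimate exists,
      (∃ θ, GaussianIDAG.IsMLE G I D θ) ∧
      ∀ θ, GaussianIDAG.IsMLE G I D θ →
        -- the BIC is given by the vector `α`,
        GaussianIDAG.bic G I D θ = GaussianIDAG.constC n I
          + ∑ i, (GaussianIDAG.alphaVec D
                ((GaussianIDAG.pa G i).disjSum (GaussianIDAG.targetingVertices I i))
              - GaussianIDAG.alphaVec D
                ((GaussianIDAG.fa G i).disjSum (GaussianIDAG.targetingVertices I i))) ∧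
        -- and it is, up to a constant that does not depend on `G`, the inner product of `α` and
        -- the standard imset of the `𝓘`-DAG.
        GaussianIDAG.bic G I D θ = GaussianIDAG.constC n I
          - GaussianIDAG.alphaVec D Finset.univ + GaussianIDAG.alphaVec D ∅
          + ∑ S, GaussianIDAG.alphaVec D S
              * (GaussianIDAG.standardImset (GaussianIDAG.iDAG G I) S : ℝ)) ∧
    -- With probability one this applies to a large enough random sample from an interventional
    -- setting of the Gaussian model of any DAG `H` with the same intervention targets.
    (∀ (H : Digraph (Fin p)), GaussianIDAG.IsDAG H →
      ∀ S ∈ GaussianIDAG.gaussianModel H I,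
      ∀ (Ω : Type*) [MeasurableSpace Ω] (μ : MeasureTheory.Measure Ω)
        [MeasureTheory.IsProbabilityMeasure μ] (X : Ω → GaussianIDAG.Data p n),
      GaussianIDAG.IsGaussianSample μ S X →
      (∀ i, (GaussianIDAG.fa G i).card ≤ ∑ k ∈ (GaussianIDAG.targeting I i)ᶜ, n k) →
      (∀ i, ∀ k ∈ GaussianIDAG.targeting I i, (GaussianIDAG.fa G i).card ≤ n k) →
      ∀ᵐ w ∂μ, GaussianIDAG.FamilyCovPosDef G I (X w)) := by
  refine ⟨fun D hD => ⟨GaussianIDAG.exists_isMLE hI hG hD, fun θ hθ => ?_⟩, ?_⟩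
  · refine ⟨hθ.bic_eq hI hG hD, ?_⟩
    rw [hθ.bic_eq hI hG hD, GaussianIDAG.sum_alphaVec_mul_standardImset]
    ring
  · intro H _ S _ Ω _ μ _ X hX h₀ h₁
    exact GaussianIDAG.ae_familyCovPosDef G I hX h₀ h₁
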